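/- **Setting.** Let $\mathbf z=(z_1,\dots,z_N)$ take values in an open, simply connected product $\mathcal Z=\mathcal Z_1\times\dots\times\mathcal Z_N\subseteq\mathbb R^N$ and have a density $p$ that is smooth on $\mathcal Z$ and positive almost everywhere on $\mathcal Z$. For $A\subseteq[N]$ let $\mathbf z_A=(z_j)_{j\in A}$ and $\mathcal Z_A=\prod_{j\in A}\mathcal Z_j$. One observes views $\mathbf x_k=f_k(\mathbf z_{S_k})$, $k=1,\dots,K$, where $S_k\subseteq[N]$ and $f_k$ is a diffeomorphism of $\mathcal Z_{S_k}$ onto $\mathcal X_k\subseteq\mathbb R^{d_k}$. A function $g$ of the views with values in $\mathbb R^{A}$ *block-identifies* $\mathbf z_A$ (with set of values $W\subseteq\mathbb R^A$) if there is a diffeomorphism $h$ of $\mathcal Z_A$ onto $W$ such that $g(\mathbf x)=h(\mathbf z_A)$ for all $\mathbf z\in\mathcal Z$. **Corollary (Identifiability Algebra: Union).** Let $C_1,C_2\subseteq[N]$, and let encoders $g_1$ of a view $\mathbf x_{k_1}$ and $g_2$ of a view $\mathbf x_{k_2}$ block-identify $\mathbf z_{C_1}$ and $\mathbf z_{C_2}$,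 with sets of values $W_1$ and $W_2$. Suppose that $\mathbf z_{C_1\cap C_2}$, $\mathbf z_{C_1\setminus C_2}$ and $\mathbf z_{C_2\setminus C_1}$ are mutually independent. Then the union $\mathbf z_{C_1\cup C_2}$ can be block-identified from the pair of representations $\hat{\mathbf c}=(g_1(\mathbf x_{k_1}),g_2(\mathbf x_{k_2}))$, by concatenating the identified intersection block and the two complement blocks. Precisely: 1. There are functions $a,b,c$, smooth on $W_1\times W_2$, such that $a(\hat{\mathbf c})$, $b(\hat{\mathbf c})$, $c(\hat{\mathbf c})$ block-identify $\mathbf z_{C_1\cap C_2}$, $\mathbf z_{C_1\setminus C_2}$, $\mathbf z_{C_2\setminus C_1}$ with sets of values $\mathcal Z_{C_1\cap C_2}$, $\mathcal Z_{C_1\setminus C_2}$, $\mathcal Z_{C_2\setminus C_1}$, and their concatenation $[a(\hat{\mathbf c}),b(\hat{\mathbf c}),c(\hat{\mathbf c})]$ block-identifies $\mathbf z_{C_1\cup C_2}$ with set of values $\mathcal Z_{C_1\cup C_2}$. 2. Whenever $a(\hat{\mathbf c})$, $b(\hat{\mathbf c})$, $c(\hat{\mathbf c})$ block-identify these three blocks,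 with any sets of values, the concatenation $[a(\hat{\mathbf c}),b(\hat{\mathbf c}),c(\hat{\mathbf c})]$ block-identifies $\mathbf z_{C_1\cup C_2}$. Moreover, this depends only on the distribution of $\hat{\mathbf c}$: for every other such model with $N$ latent variables (with any latent space, density, views and mixing functions) and every pair $\hat{\mathbf c}'$ of encoders of two of its views that satisfy the same hypotheses with the same $C_1,C_2,W_1,W_2$, if $\hat{\mathbf c}'$ and $\hat{\mathbf c}$ have the same distribution, then in that model too $[a(\hat{\mathbf c}'),b(\hat{\mathbf c}'),c(\hat{\mathbf c}')]$ block-identifies the union $\mathbf z_{C_1\cup C_2}$, and $a(\hat{\mathbf c}')$ block-identifies the intersection $\mathbf z_{C_1\cap C_2}$. -/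

import Mathlib

open scoped ContDiff

/-- The block `z_A` of the coordinates of `z` with index in `A`. -/
def subvec {N : ℕ} (A : Finset (Fin N)) (z : Fin N → ℝ) : A → ℝ := fun j => z j

/-- `f` restricts to a diffeomorphism of the set `s` onto the set `t`: it maps `s` into `t`, is
smooth on `s`, and has a two-sided inverse that is smooth on `t`. -/
def IsDiffeoOnto {E F : Type*} [NormedAddCommGroup E] [NormedSpace ℝ E]
    [NormedAddCommGroup F] [NormedSpace ℝ F] (f : E → F) (s : Set E) (t : Set F) : Prop :=
  ContDiffOn ℝ ∞ f s ∧ Set.MapsTo f s t ∧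
    ∃ f' : F → E, ContDiffOn ℝ ∞ f' t ∧ Set.MapsTo f' t s ∧
      Set.LeftInvOn f' f s ∧ Set.RightInvOn f' f t

/-- A latent variable model with `N` real latent variables and `K` views, the `k`-th one with
values in `ℝ^(d k)`. -/
structure MultiViewModel (N K : ℕ) (d : Fin K → ℕ) where
  /-- the range of the `j`-th latent variable -/
  range : Fin N → Set ℝ
  /-- the latent space, the product of the ranges, is open and simply connected -/
  isOpen_latent : IsOpen (Set.univ.pi range)
  simplyConnected_latent : SimplyConnectedSpace (Set.univ.pi range)
  /-- the density of the latent variables on the latent space -/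
  density : (Fin N → ℝ) → ℝ
  density_smooth : ContDiffOn ℝ ∞ density (Set.univ.pi range)
  density_pos : ∀ᵐ z ∂(MeasureTheory.volume.restrict (Set.univ.pi range)), 0 < density z
  density_total : ∫⁻ z in Set.univ.pi range, ENNReal.ofReal (density z) = 1
  /-- the latent variables on which the `k`-th view depends -/
  support : Fin K → Finset (Fin N)
  /-- the observation space of the `k`-th view -/
  obs : (k : Fin K) → Set (Fin (d k) → ℝ)
  /-- the mixing function of the `k`-th view, a diffeomorphism onto the observation space -/
  mix : (k : Fin K) → (support k → ℝ) → (Fin (d k) → ℝ)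
  mix_diffeo : ∀ k, IsDiffeoOnto (mix k) {u | ∀ j : support k, u j ∈ range j} (obs k)

namespace MultiViewModel

variable {N K : ℕ} {d : Fin K → ℕ}

/-- The latent space. -/
def latent (M : MultiViewModel N K d) : Set (Fin N → ℝ) := Set.univ.pi M.range

/-- The space of values of the block with index set `A`. -/
def latentBlock (M : MultiViewModel N K d) (A : Finset (Fin N)) : Set (A → ℝ) :=
  {u | ∀ j : A, u j ∈ M.range j}

/-- The law of the latent variables. -/
noncomputable def law (M : MultiViewModel N K d) : MeasureTheory.Measure (Fin N → ℝ) :=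
  (MeasureTheory.volume.restrict M.latent).withDensity fun z => ENNReal.ofReal (M.density z)

/-- All the views that are generated by the latent vector `z`. -/
def views (M : MultiViewModel N K d) (z : Fin N → ℝ) : (k : Fin K) → Fin (d k) → ℝ :=
  fun k => M.mix k (subvec (M.support k) z)

/-- The function `g` of the views block-identifies the block `z_A` with set of values `W`: one has
`g x = h z_A` for a diffeomorphism `h` of the space of values of `z_A` onto `W`. -/
def BlockIdentifiesOnto (M : MultiViewModel N K d) (A : Finset (Fin N)) (W : Set (A → ℝ))
    (g : ((k : Fin K) → Fin (d k) → ℝ) → (A → ℝ)) : Prop :=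
  ∃ h : (A → ℝ) → (A → ℝ), IsDiffeoOnto h (M.latentBlock A) W ∧
    ∀ z ∈ M.latent, g (M.views z) = h (subvec A z)

/-- The function `g` of the views block-identifies the block `z_A`. -/
def BlockIdentifies (M : MultiViewModel N K d) (A : Finset (Fin N))
    (g : ((k : Fin K) → Fin (d k) → ℝ) → (A → ℝ)) : Prop :=
  ∃ W : Set (A → ℝ), M.BlockIdentifiesOnto A W g

/-- The intersection of two blocks and their two set differences are mutually independent. -/
def PartsIndependent (M : MultiViewModel N K d) (A B : Finset (Fin N)) : Prop :=
  ProbabilityTheory.iIndepFun (fun i : Fin 3 => subvec (![A ∩ B, A \ B, B \ A] i)) M.law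

end MultiViewModel

/-- A pair of representations of the views `k₁` and `k₂`, computed by two encoders. -/
def encodePair {K : ℕ} {d : Fin K → ℕ} {α β : Type*} (k₁ k₂ : Fin K)
    (g₁ : (Fin (d k₁) → ℝ) → α) (g₂ : (Fin (d k₂) → ℝ) → β)
    (x : (k : Fin K) → Fin (d k) → ℝ) : α × β :=
  (g₁ (x k₁), g₂ (x k₂))

/-- Concatenation of vectors indexed by `A ∩ B`, `A \ B` and `B \ A`, as a vector indexed by
`A ∪ B`. -/
def concat₃ {N : ℕ} {A B : Finset (Fin N)} (a : ↥(A ∩ B) → ℝ) (b : ↥(A \ B) → ℝ)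
    (c : ↥(B \ A) → ℝ) : ↥(A ∪ B) → ℝ := fun j =>
  if hA : (j : Fin N) ∈ A then
    if hB : (j : Fin N) ∈ B then a ⟨j, Finset.mem_inter.2 ⟨hA, hB⟩⟩
    else b ⟨j, Finset.mem_sdiff.2 ⟨hA, hB⟩⟩
  else c ⟨j, Finset.mem_sdiff.2 ⟨(Finset.mem_union.1 j.2).resolve_left hA, hA⟩⟩

/-!
Suppose that two models have pairs of representations with the same sets of values `W₁`, `W₂` and
with laws of the same support. The support is the closure of the set of values of the pair, and this
set is relatively closed in `W₁ ×ˢ W₂`: decoding both components, it is cut out by the equation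
saying that the two decoded copies of `z_{C₁ ∩ C₂}` agree. Hence the two models have the same set of
values, and latent vectors `z` and `z'` of the two can be matched when they give the same pair.

Under this matching, `z_{C₁}` is a smooth function of `z'_{C₁}` and `z_{C₂}` one of `z'_{C₂}`. The
blocks with this property are closed under unions and under intersections; for the latter,
`z_{C₁ ∩ C₂}` depends neither on the coordinates of `z'` outside `C₁` nor on those outside `C₂`.
So `C₁ ∪ C₂` and `C₁ ∩ C₂` have the property in both directions, which provides diffeomorphisms
through which whatever identifies these blocks in one model identifies them in the other.
-/

open MeasureTheory

section Support

variable {X E : Type*} [TopologicalSpace X] [MeasurableSpace X] [OpensMeasurableSpace X]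
  [TopologicalSpace E] [MeasurableSpace E] [BorelSpace E]

theorem support_map_eq_closure_image {μ : Measure X} {U : Set X} {f : X → E} (hU : IsOpen U)
    (hμU : ∀ᵐ x ∂μ, x ∈ U) (hUμ : U ⊆ μ.support) (hf : ContinuousOn f U) :
    (μ.map f).support = closure (f '' U) := by
  have hfm : AEMeasurable f μ := by
    simpa only [Measure.restrict_eq_self_of_ae_mem hμU] using
      hf.aemeasurable (μ := μ) hU.measurableSet
  apply subset_antisymm
  · refine Measure.support_subset_of_isClosed isClosed_closure ?_
    refine (mem_ae_map_iff hfm isClosed_closure.measurableSet).2 ?_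
    filter_upwards [hμU] with x hx using subset_closure (Set.mem_image_of_mem f hx)
  · refine closure_minimal ?_ Measure.isClosed_support
    rintro _ ⟨x, hx, rfl⟩
    rw [Measure.support_eq_forall_isOpen]
    intro O hxO hO
    have hpre : f ⁻¹' O ∈ nhds x := (hf.continuousAt (hU.mem_nhds hx)) (hO.mem_nhds hxO)
    rw [Measure.map_apply_of_aemeasurable hfm hO.measurableSet]
    exact (Measure.mem_support_iff_forall x).1 (hUμ hx) _ hpre

end Support

section Blocks

variable {ι : Type*} {n : WithTop ℕ∞} {s t : Finset ι}

/-- The block `u_s` of a vector `u` whose coordinates are indexed by `t ⊇ s`. -/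
def subblock (h : s ⊆ t) (u : t → ℝ) : s → ℝ := fun j => u ⟨j, h j.2⟩

theorem contDiff_subblock (h : s ⊆ t) : ContDiff ℝ n (subblock h) :=
  contDiff_pi.2 fun j => contDiff_apply ℝ ℝ (⟨j, h j.2⟩ : t)

variable [DecidableEq ι]

theorem contDiff_updateFinset [Fintype ι] (x : ι → ℝ) :
    ContDiff ℝ n (Function.updateFinset x s) := by
  refine contDiff_pi.2 fun j => ?_
  by_cases hj : j ∈ s
  · simpa only [Function.updateFinset, dif_pos hj] using contDiff_apply ℝ ℝ (⟨j, hj⟩ : s)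
  · simpa only [Function.updateFinset, dif_neg hj] using contDiff_const

theorem sdiff_subset_union_left : s \ t ⊆ s ∪ t :=
  Finset.sdiff_subset.trans Finset.subset_union_left

theorem sdiff_subset_union_right : t \ s ⊆ s ∪ t :=
  Finset.sdiff_subset.trans Finset.subset_union_right

end Blocks

section Coordinates

variable {N : ℕ} {A B : Finset (Fin N)}

theorem contDiff_subvec {n : WithTop ℕ∞} (A : Finset (Fin N)) : ContDiff ℝ n (subvec A) :=
  contDiff_pi.2 fun j => contDiff_apply ℝ ℝ (j : Fin N)

theorem subvec_updateFinset (z : Fin N → ℝ) (u : A → ℝ) :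
    subvec A (Function.updateFinset z A u) = u :=
  funext fun j => dif_pos j.2

variable (A B) in
/-- The linear isomorphism that cuts a vector indexed by `A ∪ B` into its parts indexed by `A ∩ B`,
`A \ B` and `B \ A`. Its inverse is `concat₃`, so that smoothness of concatenation is automatic. -/
noncomputable def splitUnion : (↥(A ∪ B) → ℝ) ≃L[ℝ]
    (↥(A ∩ B) → ℝ) × (↥(A \ B) → ℝ) × (↥(B \ A) → ℝ) :=
  LinearEquiv.toContinuousLinearEquiv
    { toFun := fun u => (subblock Finset.inter_subset_union u,
        subblock sdiff_subset_union_left u, subblock sdiff_subset_union_right u)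
      map_add' := fun _ _ => rfl
      map_smul' := fun _ _ => rfl
      invFun := fun p => concat₃ p.1 p.2.1 p.2.2
      left_inv := fun u => by
        funext j
        simp only [concat₃]
        split_ifs <;> rfl
      right_inv := fun p => by
        refine Prod.ext ?_ (Prod.ext ?_ ?_) <;> funext j
        · have hj := Finset.mem_inter.1 j.2
          exact (dif_pos hj.1).trans (dif_pos hj.2)
        · have hj := Finset.mem_sdiff.1 j.2
          exact (dif_pos hj.1).trans (dif_neg hj.2)
        · exact dif_neg (Finset.mem_sdiff.1 j.2).2 }

theorem concat₃_subvec (z : Fin N → ℝ) :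
    concat₃ (subvec (A ∩ B) z) (subvec (A \ B) z) (subvec (B \ A) z) = subvec (A ∪ B) z :=
  (splitUnion A B).symm_apply_apply (subvec (A ∪ B) z)

end Coordinates

namespace IsDiffeoOnto

variable {E F G H : Type*} [NormedAddCommGroup E] [NormedSpace ℝ E] [NormedAddCommGroup F]
  [NormedSpace ℝ F] [NormedAddCommGroup G] [NormedSpace ℝ G] [NormedAddCommGroup H]
  [NormedSpace ℝ H]

theorem refl (s : Set E) : IsDiffeoOnto id s s :=
  ⟨contDiffOn_id, Set.mapsTo_id s, id, contDiffOn_id, Set.mapsTo_id s, Set.leftInvOn_id s,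
    Set.leftInvOn_id s⟩

theorem comp {g : F → G} {f : E → F} {s : Set E} {t : Set F} {u : Set G}
    (hg : IsDiffeoOnto g t u) (hf : IsDiffeoOnto f s t) : IsDiffeoOnto (g ∘ f) s u := by
  obtain ⟨hg, hgm, g', hg', hgm', hgl, hgr⟩ := hg
  obtain ⟨hf, hfm, f', hf', hfm', hfl, hfr⟩ := hf
  exact ⟨hg.comp hf hfm, hgm.comp hfm, f' ∘ g', hf'.comp hg' hgm', hfm'.comp hgm',
    hfl.comp hgl hfm, Set.LeftInvOn.comp hgr hfr hgm'⟩

theorem prodMap {f : E → F} {g : G → H} {s : Set E} {t : Set F} {u : Set G} {v : Set H}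
    (hf : IsDiffeoOnto f s t) (hg : IsDiffeoOnto g u v) :
    IsDiffeoOnto (Prod.map f g) (s ×ˢ u) (t ×ˢ v) := by
  obtain ⟨hf, hfm, f', hf', hfm', hfl, hfr⟩ := hf
  obtain ⟨hg, hgm, g', hg', hgm', hgl, hgr⟩ := hg
  exact ⟨hf.prodMap hg, hfm.prodMap hgm, Prod.map f' g', hf'.prodMap hg', hfm'.prodMap hgm',
    fun x hx => Prod.ext (hfl hx.1) (hgl hx.2), fun y hy => Prod.ext (hfr hy.1) (hgr hy.2)⟩

theorem continuousLinearEquiv (e : E ≃L[ℝ] F) (s : Set E) : IsDiffeoOnto e s (e '' s) :=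
  ⟨e.contDiff.contDiffOn, Set.mapsTo_image e s, e.symm, e.symm.contDiff.contDiffOn,
    Set.mapsTo_image_iff.2 fun x hx => by rwa [Function.comp_apply, e.symm_apply_apply],
    fun x _ => e.symm_apply_apply x, fun y _ => e.apply_symm_apply y⟩

end IsDiffeoOnto

namespace MultiViewModel

variable {N K K' : ℕ} {d : Fin K → ℕ} {d' : Fin K' → ℕ} {M : MultiViewModel N K d}
  {M' : MultiViewModel N K' d'} {A B : Finset (Fin N)}

section Latent

variable (M)

theorem latent_nonempty : M.latent.Nonempty := by
  have := M.simplyConnected_latent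
  exact Set.nonempty_coe_sort.1 (inferInstanceAs (Nonempty (Set.univ.pi M.range)))

theorem ae_law_mem_latent : ∀ᵐ z ∂M.law, z ∈ M.latent :=
  withDensity_absolutelyContinuous _ _ (ae_restrict_mem M.isOpen_latent.measurableSet)

theorem latent_subset_support_law : M.latent ⊆ M.law.support := by
  have hac : volume.restrict M.latent ≪ M.law := by
    refine withDensity_absolutelyContinuous' ?_ ?_
    · exact (M.density_smooth.continuousOn.aemeasurable
        M.isOpen_latent.measurableSet).ennreal_ofReal
    · filter_upwards [M.density_pos] with z hz using (ENNReal.ofReal_pos.2 hz).ne'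
  refine subset_trans ?_ hac.support_mono
  simpa only [M.isOpen_latent.interior_eq, Measure.support_eq_univ, Set.inter_univ, latent] using
    Measure.interior_inter_support (μ := volume) (s := M.latent)

variable {M}

theorem support_map_law {E : Type*} [TopologicalSpace E] [MeasurableSpace E] [BorelSpace E]
    {f : (Fin N → ℝ) → E} (hf : ContinuousOn f M.latent) :
    (M.law.map f).support = closure (f '' M.latent) :=
  support_map_eq_closure_image M.isOpen_latent M.ae_law_mem_latent M.latent_subset_support_law hf

theorem subvec_mem_latentBlock {z : Fin N → ℝ} (hz : z ∈ M.latent) (A : Finset (Fin N)) :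
    subvec A z ∈ M.latentBlock A :=
  fun j => hz j trivial

theorem subblock_mem_latentBlock (h : A ⊆ B) {u : B → ℝ} (hu : u ∈ M.latentBlock B) :
    subblock h u ∈ M.latentBlock A :=
  fun j => hu ⟨j, h j.2⟩

theorem updateFinset_mem_latent {z : Fin N → ℝ} {u : A → ℝ} (hz : z ∈ M.latent)
    (hu : u ∈ M.latentBlock A) : Function.updateFinset z A u ∈ M.latent := by
  intro j _
  by_cases hj : j ∈ A
  · simpa only [Function.updateFinset, dif_pos hj] using hu ⟨j, hj⟩
  · simpa only [Function.updateFinset, dif_neg hj] using hz j trivial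

theorem exists_mem_latent_subvec_eq {u : A → ℝ} (hu : u ∈ M.latentBlock A) :
    ∃ z ∈ M.latent, subvec A z = u :=
  let ⟨z, hz⟩ := M.latent_nonempty
  ⟨_, updateFinset_mem_latent hz hu, subvec_updateFinset z u⟩

theorem exists_mem_latent_subvec_eq_and_subvec_eq {u : A → ℝ} {v : B → ℝ}
    (hu : u ∈ M.latentBlock A) (hv : v ∈ M.latentBlock B)
    (huv : subblock (Finset.inter_subset_left : A ∩ B ⊆ A) u =
      subblock Finset.inter_subset_right v) :
    ∃ z ∈ M.latent, subvec A z = u ∧ subvec B z = v := by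
  obtain ⟨z, hz, rfl⟩ := exists_mem_latent_subvec_eq hv
  refine ⟨_, updateFinset_mem_latent hz hu, subvec_updateFinset z u, funext fun j => ?_⟩
  by_cases hj : (j : Fin N) ∈ A
  · exact (dif_pos hj).trans (congrFun huv ⟨j, Finset.mem_inter.2 ⟨hj, j.2⟩⟩)
  · exact dif_neg hj

theorem image_splitUnion_latentBlock :
    splitUnion A B '' M.latentBlock (A ∪ B) =
      M.latentBlock (A ∩ B) ×ˢ M.latentBlock (A \ B) ×ˢ M.latentBlock (B \ A) := by
  have h_preimage : M.latentBlock (A ∪ B) = splitUnion A B ⁻¹'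
      (M.latentBlock (A ∩ B) ×ˢ M.latentBlock (A \ B) ×ˢ M.latentBlock (B \ A)) := by
    refine subset_antisymm (fun u hu => ?_) ?_
    · exact ⟨subblock_mem_latentBlock Finset.inter_subset_union hu,
        subblock_mem_latentBlock sdiff_subset_union_left hu,
        subblock_mem_latentBlock sdiff_subset_union_right hu⟩
    · rintro u ⟨hI, hL, hR⟩ j
      by_cases hA : (j : Fin N) ∈ A
      · by_cases hB : (j : Fin N) ∈ B
        · exact hI ⟨j, Finset.mem_inter.2 ⟨hA, hB⟩⟩
        · exact hL ⟨j, Finset.mem_sdiff.2 ⟨hA, hB⟩⟩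
      · exact hR ⟨j, Finset.mem_sdiff.2 ⟨(Finset.mem_union.1 j.2).resolve_left hA, hA⟩⟩
  rw [h_preimage, Set.image_preimage_eq _ (splitUnion A B).surjective]

end Latent

section BlockIdentifies

variable {g : ((k : Fin K) → Fin (d k) → ℝ) → A → ℝ} {W : Set (A → ℝ)}

theorem blockIdentifiesOnto_of_eq_subvec (hg : ∀ z ∈ M.latent, g (M.views z) = subvec A z) :
    M.BlockIdentifiesOnto A (M.latentBlock A) g :=
  ⟨id, IsDiffeoOnto.refl _, hg⟩

theorem BlockIdentifiesOnto.continuousOn (hg : M.BlockIdentifiesOnto A W g) :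
    ContinuousOn (fun z => g (M.views z)) M.latent := by
  obtain ⟨h, hh, hgh⟩ := hg
  exact (hh.1.continuousOn.comp (contDiff_subvec (n := ∞) A).continuous.continuousOn
    fun z hz => subvec_mem_latentBlock hz A).congr hgh

theorem BlockIdentifiesOnto.mapsTo (hg : M.BlockIdentifiesOnto A W g) :
    Set.MapsTo (fun z => g (M.views z)) M.latent W := by
  obtain ⟨h, hh, hgh⟩ := hg
  intro z hz
  simpa only [hgh z hz] using hh.2.1 (subvec_mem_latentBlock hz A)

theorem BlockIdentifiesOnto.exists_decoder (hg : M.BlockIdentifiesOnto A W g) :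
    ∃ e : (A → ℝ) → A → ℝ, ContDiffOn ℝ ∞ e W ∧ Set.MapsTo e W (M.latentBlock A) ∧
      (∀ z ∈ M.latent, e (g (M.views z)) = subvec A z) ∧
      ∀ w ∈ W, ∀ z ∈ M.latent, subvec A z = e w → g (M.views z) = w := by
  obtain ⟨h, ⟨-, -, e, he, hem, hl, hr⟩, hgh⟩ := hg
  refine ⟨e, he, hem, fun z hz => ?_, fun w hw z hz hzw => ?_⟩
  · rw [hgh z hz, hl (subvec_mem_latentBlock hz A)]
  · rw [hgh z hz, hzw, hr hw]

theorem BlockIdentifies.concat₃ {a : ((k : Fin K) → Fin (d k) → ℝ) → ↥(A ∩ B) → ℝ}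
    {b : ((k : Fin K) → Fin (d k) → ℝ) → ↥(A \ B) → ℝ}
    {c : ((k : Fin K) → Fin (d k) → ℝ) → ↥(B \ A) → ℝ} (ha : M.BlockIdentifies (A ∩ B) a)
    (hb : M.BlockIdentifies (A \ B) b) (hc : M.BlockIdentifies (B \ A) c) :
    M.BlockIdentifies (A ∪ B) fun x => concat₃ (a x) (b x) (c x) := by
  obtain ⟨U, α, hα, haα⟩ := ha
  obtain ⟨V, β, hβ, hbβ⟩ := hb
  obtain ⟨W, γ, hγ, hcγ⟩ := hc
  have hsplit : IsDiffeoOnto (splitUnion A B) (M.latentBlock (A ∪ B))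
      (M.latentBlock (A ∩ B) ×ˢ M.latentBlock (A \ B) ×ˢ M.latentBlock (B \ A)) :=
    image_splitUnion_latentBlock (M := M) ▸ IsDiffeoOnto.continuousLinearEquiv _ _
  have hconcat := IsDiffeoOnto.continuousLinearEquiv (splitUnion A B).symm (U ×ˢ V ×ˢ W)
  refine ⟨_, _, hconcat.comp ((hα.prodMap (hβ.prodMap hγ)).comp hsplit), fun z hz => ?_⟩
  simp only [haα z hz, hbβ z hz, hcγ z hz]
  rfl

end BlockIdentifies

section Transition

variable {Y Z : Type*} {f f' : (Fin N → ℝ) → Y}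

/-- Match the latent vectors `z` of `M` and `z'` of `M'` whenever `f z = f' z'`. The block `A` has a
smooth transition from `M'` to `M` if, for matched vectors, `z_A` is a smooth function of `z'_A`. -/
def HasSmoothTransition (M : MultiViewModel N K d) (M' : MultiViewModel N K' d')
    (f f' : (Fin N → ℝ) → Y) (A : Finset (Fin N)) : Prop :=
  ∃ ψ : (A → ℝ) → A → ℝ, ContDiffOn ℝ ∞ ψ (M'.latentBlock A) ∧
    ∀ z ∈ M.latent, ∀ z' ∈ M'.latent, f z = f' z' → ψ (subvec A z') = subvec A z

namespace HasSmoothTransition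

theorem of_comp (p : Y → Z) (h : HasSmoothTransition M M' (p ∘ f) (p ∘ f') A) :
    HasSmoothTransition M M' f f' A :=
  let ⟨ψ, hψ, hψm⟩ := h
  ⟨ψ, hψ, fun z hz z' hz' hzz' => hψm z hz z' hz' (congrArg p hzz')⟩

theorem of_blockIdentifiesOnto {W : Set (A → ℝ)} {g : ((k : Fin K) → Fin (d k) → ℝ) → A → ℝ}
    {g' : ((k : Fin K') → Fin (d' k) → ℝ) → A → ℝ} (hg : M.BlockIdentifiesOnto A W g)
    (hg' : M'.BlockIdentifiesOnto A W g') :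
    HasSmoothTransition M M' (fun z => g (M.views z)) (fun z => g' (M'.views z)) A := by
  obtain ⟨e, he, -, heg, -⟩ := hg.exists_decoder
  obtain ⟨h', hh', hgh'⟩ := hg'
  refine ⟨e ∘ h', he.comp hh'.1 hh'.2.1,
    fun z hz z' hz' (hzz' : g (M.views z) = g' (M'.views z')) => ?_⟩
  rw [Function.comp_apply, ← hgh' z' hz', ← hzz', heg z hz]

theorem union (hA : HasSmoothTransition M M' f f' A) (hB : HasSmoothTransition M M' f f' B) :
    HasSmoothTransition M M' f f' (A ∪ B) := by
  obtain ⟨φ, hφ, hφm⟩ := hA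
  obtain ⟨χ, hχ, hχm⟩ := hB
  have hφ' := hφ.comp (contDiff_subblock Finset.subset_union_left).contDiffOn
    fun u (hu : u ∈ M'.latentBlock (A ∪ B)) => subblock_mem_latentBlock _ hu
  have hχ' := hχ.comp (contDiff_subblock Finset.subset_union_right).contDiffOn
    fun u (hu : u ∈ M'.latentBlock (A ∪ B)) => subblock_mem_latentBlock _ hu
  refine ⟨_, (splitUnion A B).symm.contDiff.comp_contDiffOn
    (((contDiff_subblock Finset.inter_subset_left).comp_contDiffOn hφ').prodMk
      (((contDiff_subblock Finset.sdiff_subset).comp_contDiffOn hφ').prodMk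
        ((contDiff_subblock Finset.sdiff_subset).comp_contDiffOn hχ'))),
    fun z hz z' hz' hzz' => ?_⟩
  rw [← concat₃_subvec z]
  exact congrArg₂ (fun u v => concat₃ (subblock Finset.inter_subset_left u)
    (subblock Finset.sdiff_subset u) (subblock Finset.sdiff_subset v))
    (hφm z hz z' hz' hzz') (hχm z hz z' hz' hzz')

theorem inter (hA : HasSmoothTransition M M' f f' A) (hB : HasSmoothTransition M M' f f' B)
    (hff' : f' '' M'.latent ⊆ f '' M.latent) : HasSmoothTransition M M' f f' (A ∩ B) := by
  obtain ⟨φ, hφ, hφm⟩ := hA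
  obtain ⟨χ, -, hχm⟩ := hB
  obtain ⟨z₀, hz₀⟩ := M'.latent_nonempty
  let extend (u : ↥(A ∩ B) → ℝ) : A → ℝ := subvec A (Function.updateFinset z₀ (A ∩ B) u)
  have h_extend : ContDiffOn ℝ ∞ extend (M'.latentBlock (A ∩ B)) :=
    ((contDiff_subvec A).comp (contDiff_updateFinset z₀)).contDiffOn
  refine ⟨subblock Finset.inter_subset_left ∘ φ ∘ extend,
    (contDiff_subblock _).comp_contDiffOn (hφ.comp h_extend fun u hu =>
      subvec_mem_latentBlock (updateFinset_mem_latent hz₀ hu) A), fun z hz z' hz' hzz' => ?_⟩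
  -- Replacing `z'` by `y` keeps `z_B`, hence `z_{A ∩ B}`, while `y_A` depends only on `z'_{A ∩ B}`.
  let y := Function.updateFinset z₀ B (subvec B z')
  have hy : y ∈ M'.latent := updateFinset_mem_latent hz₀ (subvec_mem_latentBlock hz' B)
  have hyA : subvec A y = extend (subvec (A ∩ B) z') := by
    funext j
    simp [y, extend, subvec, Function.updateFinset]
  have hyB : subvec B y = subvec B z' := subvec_updateFinset z₀ (subvec B z')
  obtain ⟨x, hx, hxy⟩ := hff' (Set.mem_image_of_mem f' hy)
  have hxA : φ (extend (subvec (A ∩ B) z')) = subvec A x := hyA ▸ hφm x hx y hy hxy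
  have hxB : subvec B x = subvec B z := by
    rw [← hχm x hx y hy hxy, hyB, hχm z hz z' hz' hzz']
  rw [Function.comp_apply, Function.comp_apply, hxA]
  exact congrArg (subblock Finset.inter_subset_right) hxB

theorem exists_isDiffeoOnto (h : HasSmoothTransition M M' f f' A)
    (h' : HasSmoothTransition M' M f' f A) (hff' : f '' M.latent = f' '' M'.latent) :
    ∃ ψ : (A → ℝ) → A → ℝ, IsDiffeoOnto ψ (M'.latentBlock A) (M.latentBlock A) ∧
      ∀ z ∈ M.latent, ∀ z' ∈ M'.latent, f z = f' z' → ψ (subvec A z') = subvec A z := by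
  obtain ⟨ψ, hψ, hψm⟩ := h
  obtain ⟨ψ', hψ', hψm'⟩ := h'
  have matched' : ∀ u' ∈ M'.latentBlock A, ∃ z ∈ M.latent, ψ u' = subvec A z ∧
      ψ' (subvec A z) = u' := by
    intro u' hu'
    obtain ⟨z', hz', rfl⟩ := exists_mem_latent_subvec_eq hu'
    obtain ⟨z, hz, hzz'⟩ := hff'.ge (Set.mem_image_of_mem f' hz')
    exact ⟨z, hz, hψm z hz z' hz' hzz', hψm' z' hz' z hz hzz'.symm⟩
  have matched : ∀ u ∈ M.latentBlock A, ∃ z' ∈ M'.latent, ψ' u = subvec A z' ∧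
      ψ (subvec A z') = u := by
    intro u hu
    obtain ⟨z, hz, rfl⟩ := exists_mem_latent_subvec_eq hu
    obtain ⟨z', hz', hzz'⟩ := hff'.le (Set.mem_image_of_mem f hz)
    exact ⟨z', hz', hψm' z' hz' z hz hzz', hψm z hz z' hz' hzz'.symm⟩
  refine ⟨ψ, ⟨hψ, fun u' hu' => ?_, ψ', hψ', fun u hu => ?_, fun u' hu' => ?_, fun u hu => ?_⟩,
    hψm⟩
  · obtain ⟨z, hz, hu, -⟩ := matched' u' hu'
    exact hu ▸ subvec_mem_latentBlock hz A
  · obtain ⟨z', hz', hu', -⟩ := matched u hu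
    exact hu' ▸ subvec_mem_latentBlock hz' A
  · obtain ⟨z, -, hu, hu'⟩ := matched' u' hu'
    rw [hu, hu']
  · obtain ⟨z', -, hu', hu⟩ := matched u hu
    rw [hu', hu]

theorem blockIdentifies {r : ((k : Fin K) → Fin (d k) → ℝ) → Y}
    {r' : ((k : Fin K') → Fin (d' k) → ℝ) → Y}
    (h : HasSmoothTransition M M' (fun z => r (M.views z)) (fun z => r' (M'.views z)) A)
    (h' : HasSmoothTransition M' M (fun z => r' (M'.views z)) (fun z => r (M.views z)) A)
    (hrr' : (fun z => r (M.views z)) '' M.latent = (fun z => r' (M'.views z)) '' M'.latent)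
    {q : Y → A → ℝ} (hq : M.BlockIdentifies A fun x => q (r x)) :
    M'.BlockIdentifies A fun x => q (r' x) := by
  obtain ⟨ψ, hψ, hψm⟩ := h.exists_isDiffeoOnto h' hrr'
  obtain ⟨W, α, hα, hqα⟩ := hq
  refine ⟨W, α ∘ ψ, hα.comp hψ, fun z' hz' => ?_⟩
  obtain ⟨z, hz, hzz' : r (M.views z) = r' (M'.views z')⟩ :=
    hrr'.ge (Set.mem_image_of_mem _ hz')
  calc q (r' (M'.views z')) = q (r (M.views z)) := congrArg q hzz'.symm
    _ = α (subvec A z) := hqα z hz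
    _ = α (ψ (subvec A z')) := congrArg α (hψm z hz z' hz' hzz').symm

end HasSmoothTransition

end Transition

section Pair

variable {W₁ : Set (A → ℝ)} {W₂ : Set (B → ℝ)}
  {g₁ : ((k : Fin K) → Fin (d k) → ℝ) → A → ℝ} {g₂ : ((k : Fin K) → Fin (d k) → ℝ) → B → ℝ}
  {g₁' : ((k : Fin K') → Fin (d' k) → ℝ) → A → ℝ} {g₂' : ((k : Fin K') → Fin (d' k) → ℝ) → B → ℝ}

theorem closure_image_pair_inter_subset (hg₁ : M.BlockIdentifiesOnto A W₁ g₁)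
    (hg₂ : M.BlockIdentifiesOnto B W₂ g₂) :
    closure ((fun z => (g₁ (M.views z), g₂ (M.views z))) '' M.latent) ∩ W₁ ×ˢ W₂ ⊆
      (fun z => (g₁ (M.views z), g₂ (M.views z))) '' M.latent := by
  obtain ⟨e₁, he₁, hem₁, heg₁, hge₁⟩ := hg₁.exists_decoder
  obtain ⟨e₂, he₂, hem₂, heg₂, hge₂⟩ := hg₂.exists_decoder
  let S := (fun z => (g₁ (M.views z), g₂ (M.views z))) '' M.latent
  let p (w : (A → ℝ) × (B → ℝ)) : ↥(A ∩ B) → ℝ := subblock Finset.inter_subset_left (e₁ w.1)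
  let q (w : (A → ℝ) × (B → ℝ)) : ↥(A ∩ B) → ℝ := subblock Finset.inter_subset_right (e₂ w.2)
  have hp : ContinuousOn p (W₁ ×ˢ W₂) :=
    (contDiff_subblock (n := ∞) _).continuous.comp_continuousOn
      (he₁.continuousOn.comp continuousOn_fst fun _ hw => hw.1)
  have hq : ContinuousOn q (W₁ ×ˢ W₂) :=
    (contDiff_subblock (n := ∞) _).continuous.comp_continuousOn
      (he₂.continuousOn.comp continuousOn_snd fun _ hw => hw.2)
  have hSW : S ⊆ W₁ ×ˢ W₂ := Set.image_subset_iff.2 fun z hz => ⟨hg₁.mapsTo hz, hg₂.mapsTo hz⟩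
  have hpq : Set.EqOn p q S := by
    rintro _ ⟨z, hz, rfl⟩
    simp only [p, q, heg₁ z hz, heg₂ z hz]
    rfl
  have hpq_closure : Set.EqOn p q (closure S ∩ W₁ ×ˢ W₂) :=
    hpq.of_subset_closure (hp.mono Set.inter_subset_right) (hq.mono Set.inter_subset_right)
      (Set.subset_inter subset_closure hSW) Set.inter_subset_left
  rintro w ⟨hwS, hw₁, hw₂⟩
  obtain ⟨z, hz, hzA, hzB⟩ := exists_mem_latent_subvec_eq_and_subvec_eq (hem₁ hw₁) (hem₂ hw₂)
    (hpq_closure ⟨hwS, hw₁, hw₂⟩)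
  exact ⟨z, hz, Prod.ext (hge₁ _ hw₁ z hz hzA) (hge₂ _ hw₂ z hz hzB)⟩

theorem image_pair_subset_of_support_map_law_eq (hg₁ : M.BlockIdentifiesOnto A W₁ g₁)
    (hg₂ : M.BlockIdentifiesOnto B W₂ g₂) (hg₁' : M'.BlockIdentifiesOnto A W₁ g₁')
    (hg₂' : M'.BlockIdentifiesOnto B W₂ g₂')
    (hsupp : (M'.law.map fun z => (g₁' (M'.views z), g₂' (M'.views z))).support =
      (M.law.map fun z => (g₁ (M.views z), g₂ (M.views z))).support) :
    (fun z => (g₁' (M'.views z), g₂' (M'.views z))) '' M'.latent ⊆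
      (fun z => (g₁ (M.views z), g₂ (M.views z))) '' M.latent := by
  rw [support_map_law (hg₁'.continuousOn.prodMk hg₂'.continuousOn),
    support_map_law (hg₁.continuousOn.prodMk hg₂.continuousOn)] at hsupp
  refine subset_trans (Set.subset_inter (subset_closure.trans hsupp.le) ?_)
    (closure_image_pair_inter_subset hg₁ hg₂)
  exact Set.image_subset_iff.2 fun z hz => ⟨hg₁'.mapsTo hz, hg₂'.mapsTo hz⟩

theorem HasSmoothTransition.pair_left (hg₁ : M.BlockIdentifiesOnto A W₁ g₁)
    (hg₁' : M'.BlockIdentifiesOnto A W₁ g₁') :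
    HasSmoothTransition M M' (fun z => (g₁ (M.views z), g₂ (M.views z)))
      (fun z => (g₁' (M'.views z), g₂' (M'.views z))) A :=
  (of_blockIdentifiesOnto hg₁ hg₁').of_comp Prod.fst

theorem HasSmoothTransition.pair_right (hg₂ : M.BlockIdentifiesOnto B W₂ g₂)
    (hg₂' : M'.BlockIdentifiesOnto B W₂ g₂') :
    HasSmoothTransition M M' (fun z => (g₁ (M.views z), g₂ (M.views z)))
      (fun z => (g₁' (M'.views z), g₂' (M'.views z))) B :=
  (of_blockIdentifiesOnto hg₂ hg₂').of_comp Prod.snd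

theorem exists_decoded_parts (hg₁ : M.BlockIdentifiesOnto A W₁ g₁)
    (hg₂ : M.BlockIdentifiesOnto B W₂ g₂) :
    ∃ (a : (A → ℝ) × (B → ℝ) → (↥(A ∩ B) → ℝ)) (b : (A → ℝ) × (B → ℝ) → (↥(A \ B) → ℝ))
       (c : (A → ℝ) × (B → ℝ) → (↥(B \ A) → ℝ)),
      ContDiffOn ℝ ∞ a (W₁ ×ˢ W₂) ∧ ContDiffOn ℝ ∞ b (W₁ ×ˢ W₂) ∧ ContDiffOn ℝ ∞ c (W₁ ×ˢ W₂) ∧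
      ∀ z ∈ M.latent, a (g₁ (M.views z), g₂ (M.views z)) = subvec (A ∩ B) z ∧
        b (g₁ (M.views z), g₂ (M.views z)) = subvec (A \ B) z ∧
        c (g₁ (M.views z), g₂ (M.views z)) = subvec (B \ A) z := by
  obtain ⟨e₁, he₁, -, heg₁, -⟩ := hg₁.exists_decoder
  obtain ⟨e₂, he₂, -, heg₂, -⟩ := hg₂.exists_decoder
  have he₁' : ContDiffOn ℝ ∞ (fun w : (A → ℝ) × (B → ℝ) => e₁ w.1) (W₁ ×ˢ W₂) :=
    he₁.comp contDiff_fst.contDiffOn fun _ hw => hw.1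
  have he₂' : ContDiffOn ℝ ∞ (fun w : (A → ℝ) × (B → ℝ) => e₂ w.2) (W₁ ×ˢ W₂) :=
    he₂.comp contDiff_snd.contDiffOn fun _ hw => hw.2
  exact ⟨_, _, _, (contDiff_subblock Finset.inter_subset_left).comp_contDiffOn he₁',
    (contDiff_subblock Finset.sdiff_subset).comp_contDiffOn he₁',
    (contDiff_subblock Finset.sdiff_subset).comp_contDiffOn he₂', fun z hz =>
    ⟨congrArg (subblock Finset.inter_subset_left) (heg₁ z hz),
      congrArg (subblock Finset.sdiff_subset) (heg₁ z hz),
      congrArg (subblock Finset.sdiff_subset) (heg₂ z hz)⟩⟩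

end Pair

end MultiViewModel

open MultiViewModel in
theorem mainTheorem5_general {N K : ℕ} {d : Fin K → ℕ} (M : MultiViewModel N K d)
    {A B : Finset (Fin N)} {W₁ : Set (A → ℝ)} {W₂ : Set (B → ℝ)}
    {g₁ : ((k : Fin K) → Fin (d k) → ℝ) → A → ℝ} {g₂ : ((k : Fin K) → Fin (d k) → ℝ) → B → ℝ}
    (hg₁ : M.BlockIdentifiesOnto A W₁ g₁) (hg₂ : M.BlockIdentifiesOnto B W₂ g₂) :
    (∃ (a : (A → ℝ) × (B → ℝ) → (↥(A ∩ B) → ℝ)) (b : (A → ℝ) × (B → ℝ) → (↥(A \ B) → ℝ))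
       (c : (A → ℝ) × (B → ℝ) → (↥(B \ A) → ℝ)),
      ContDiffOn ℝ ∞ a (W₁ ×ˢ W₂) ∧ ContDiffOn ℝ ∞ b (W₁ ×ˢ W₂) ∧ ContDiffOn ℝ ∞ c (W₁ ×ˢ W₂) ∧
      M.BlockIdentifiesOnto (A ∩ B) (M.latentBlock (A ∩ B)) (fun x => a (g₁ x, g₂ x)) ∧
      M.BlockIdentifiesOnto (A \ B) (M.latentBlock (A \ B)) (fun x => b (g₁ x, g₂ x)) ∧
      M.BlockIdentifiesOnto (B \ A) (M.latentBlock (B \ A)) (fun x => c (g₁ x, g₂ x)) ∧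
      M.BlockIdentifiesOnto (A ∪ B) (M.latentBlock (A ∪ B))
        (fun x => concat₃ (a (g₁ x, g₂ x)) (b (g₁ x, g₂ x)) (c (g₁ x, g₂ x)))) ∧
    (∀ (a : (A → ℝ) × (B → ℝ) → (↥(A ∩ B) → ℝ)) (b : (A → ℝ) × (B → ℝ) → (↥(A \ B) → ℝ))
       (c : (A → ℝ) × (B → ℝ) → (↥(B \ A) → ℝ)),
      M.BlockIdentifies (A ∩ B) (fun x => a (g₁ x, g₂ x)) →
      M.BlockIdentifies (A \ B) (fun x => b (g₁ x, g₂ x)) →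
      M.BlockIdentifies (B \ A) (fun x => c (g₁ x, g₂ x)) →
      M.BlockIdentifies (A ∪ B)
        (fun x => concat₃ (a (g₁ x, g₂ x)) (b (g₁ x, g₂ x)) (c (g₁ x, g₂ x))) ∧
      ∀ {K' : ℕ} {d' : Fin K' → ℕ} (M' : MultiViewModel N K' d')
        {g₁' : ((k : Fin K') → Fin (d' k) → ℝ) → A → ℝ}
        {g₂' : ((k : Fin K') → Fin (d' k) → ℝ) → B → ℝ},
        M'.BlockIdentifiesOnto A W₁ g₁' → M'.BlockIdentifiesOnto B W₂ g₂' →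
        (M'.law.map fun z => (g₁' (M'.views z), g₂' (M'.views z))).support =
          (M.law.map fun z => (g₁ (M.views z), g₂ (M.views z))).support →
        M'.BlockIdentifies (A ∩ B) (fun x => a (g₁' x, g₂' x)) ∧
        M'.BlockIdentifies (A ∪ B)
          (fun x => concat₃ (a (g₁' x, g₂' x)) (b (g₁' x, g₂' x)) (c (g₁' x, g₂' x)))) := by
  constructor
  · obtain ⟨a, b, c, ha, hb, hc, habc⟩ := exists_decoded_parts hg₁ hg₂
    refine ⟨a, b, c, ha, hb, hc, blockIdentifiesOnto_of_eq_subvec fun z hz => (habc z hz).1,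
      blockIdentifiesOnto_of_eq_subvec fun z hz => (habc z hz).2.1,
      blockIdentifiesOnto_of_eq_subvec fun z hz => (habc z hz).2.2,
      blockIdentifiesOnto_of_eq_subvec fun z hz => ?_⟩
    rw [(habc z hz).1, (habc z hz).2.1, (habc z hz).2.2, concat₃_subvec]
  · intro a b c ha hb hc
    have habc := ha.concat₃ hb hc
    refine ⟨habc, fun {K' d'} M' {g₁' g₂'} hg₁' hg₂' hsupp => ?_⟩
    have himage' := image_pair_subset_of_support_map_law_eq hg₁ hg₂ hg₁' hg₂' hsupp
    have himage := image_pair_subset_of_support_map_law_eq hg₁' hg₂' hg₁ hg₂ hsupp.symm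
    have hA := HasSmoothTransition.pair_left (g₂ := g₂) (g₂' := g₂') hg₁ hg₁'
    have hB := HasSmoothTransition.pair_right (g₁ := g₁) (g₁' := g₁') hg₂ hg₂'
    have hA' := HasSmoothTransition.pair_left (g₂ := g₂') (g₂' := g₂) hg₁' hg₁
    have hB' := HasSmoothTransition.pair_right (g₁ := g₁') (g₁' := g₁) hg₂' hg₂
    have himage_eq := subset_antisymm himage himage'
    exact ⟨(hA.inter hB himage').blockIdentifies (hA'.inter hB' himage) himage_eq ha,
      (hA.union hB).blockIdentifies (hA'.union hB') himage_eq
        (q := fun w => concat₃ (a w) (b w) (c w)) habc⟩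

theorem mainTheorem5 {N K : ℕ} {d : Fin K → ℕ} (M : MultiViewModel N K d)
    (C₁ C₂ : Finset (Fin N)) (W₁ : Set (C₁ → ℝ)) (W₂ : Set (C₂ → ℝ))
    (k₁ k₂ : Fin K)
    (g₁ : (Fin (d k₁) → ℝ) → (C₁ → ℝ)) (g₂ : (Fin (d k₂) → ℝ) → (C₂ → ℝ))
    (hg₁ : M.BlockIdentifiesOnto C₁ W₁ fun x => g₁ (x k₁))
    (hg₂ : M.BlockIdentifiesOnto C₂ W₂ fun x => g₂ (x k₂))
    (hind : M.PartsIndependent C₁ C₂) :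
    -- the parts are block-identified by smooth functions of the two representations, and their
    -- concatenation block-identifies the union
    (∃ (a : (C₁ → ℝ) × (C₂ → ℝ) → (↥(C₁ ∩ C₂) → ℝ))
       (b : (C₁ → ℝ) × (C₂ → ℝ) → (↥(C₁ \ C₂) → ℝ))
       (c : (C₁ → ℝ) × (C₂ → ℝ) → (↥(C₂ \ C₁) → ℝ)),
      ContDiffOn ℝ ∞ a (W₁ ×ˢ W₂) ∧ ContDiffOn ℝ ∞ b (W₁ ×ˢ W₂) ∧
      ContDiffOn ℝ ∞ c (W₁ ×ˢ W₂) ∧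
      M.BlockIdentifiesOnto (C₁ ∩ C₂) (M.latentBlock (C₁ ∩ C₂))
        (fun x => a (encodePair k₁ k₂ g₁ g₂ x)) ∧
      M.BlockIdentifiesOnto (C₁ \ C₂) (M.latentBlock (C₁ \ C₂))
        (fun x => b (encodePair k₁ k₂ g₁ g₂ x)) ∧
      M.BlockIdentifiesOnto (C₂ \ C₁) (M.latentBlock (C₂ \ C₁))
        (fun x => c (encodePair k₁ k₂ g₁ g₂ x)) ∧
      M.BlockIdentifiesOnto (C₁ ∪ C₂) (M.latentBlock (C₁ ∪ C₂))
        (fun x => concat₃ (a (encodePair k₁ k₂ g₁ g₂ x)) (b (encodePair k₁ k₂ g₁ g₂ x))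
          (c (encodePair k₁ k₂ g₁ g₂ x)))) ∧
    -- whichever functions block-identify the parts, their concatenation block-identifies the union,
    -- in this model and in every other one with the same law of the pair of representations
    (∀ (a : (C₁ → ℝ) × (C₂ → ℝ) → (↥(C₁ ∩ C₂) → ℝ))
       (b : (C₁ → ℝ) × (C₂ → ℝ) → (↥(C₁ \ C₂) → ℝ))
       (c : (C₁ → ℝ) × (C₂ → ℝ) → (↥(C₂ \ C₁) → ℝ)),
      M.BlockIdentifies (C₁ ∩ C₂) (fun x => a (encodePair k₁ k₂ g₁ g₂ x)) →
      M.BlockIdentifies (C₁ \ C₂) (fun x => b (encodePair k₁ k₂ g₁ g₂ x)) →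
      M.BlockIdentifies (C₂ \ C₁) (fun x => c (encodePair k₁ k₂ g₁ g₂ x)) →
      M.BlockIdentifies (C₁ ∪ C₂)
        (fun x => concat₃ (a (encodePair k₁ k₂ g₁ g₂ x)) (b (encodePair k₁ k₂ g₁ g₂ x))
          (c (encodePair k₁ k₂ g₁ g₂ x))) ∧
      ∀ (K' : ℕ) (d' : Fin K' → ℕ) (M' : MultiViewModel N K' d') (l₁ l₂ : Fin K')
        (g₁' : (Fin (d' l₁) → ℝ) → (C₁ → ℝ)) (g₂' : (Fin (d' l₂) → ℝ) → (C₂ → ℝ)),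
        M'.BlockIdentifiesOnto C₁ W₁ (fun x => g₁' (x l₁)) →
        M'.BlockIdentifiesOnto C₂ W₂ (fun x => g₂' (x l₂)) →
        M'.PartsIndependent C₁ C₂ →
        M'.law.map (fun z => encodePair l₁ l₂ g₁' g₂' (M'.views z)) =
          M.law.map (fun z => encodePair k₁ k₂ g₁ g₂ (M.views z)) →
        M'.BlockIdentifies (C₁ ∩ C₂) (fun x => a (encodePair l₁ l₂ g₁' g₂' x)) ∧
        M'.BlockIdentifies (C₁ ∪ C₂)
          (fun x => concat₃ (a (encodePair l₁ l₂ g₁' g₂' x)) (b (encodePair l₁ l₂ g₁' g₂' x))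
            (c (encodePair l₁ l₂ g₁' g₂' x)))) := by
  obtain ⟨hparts, htransfer⟩ := mainTheorem5_general M hg₁ hg₂
  exact ⟨hparts, fun a b c ha hb hc => ⟨(htransfer a b c ha hb hc).1,
    fun _ _ M' _ _ _ _ hg₁' hg₂' _ hlaw =>
      (htransfer a b c ha hb hc).2 M' hg₁' hg₂' (congrArg MeasureTheory.Measure.support hlaw)⟩⟩
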